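/- Let $r,\delta,\lambda>0$ and $x^*\ge 0$. Let $0=\tau_0<\tau_1<\tau_2<\cdots$ be the arrival times of a Poisson process of intensity $\lambda$ (i.e. the waiting times $\tau_{i}-\tau_{i-1}$ are i.i.d. exponential with parameter $\lambda$), and let $(Z_i)_{i\ge1}$ be i.i.d. random variables with distribution function $G_Z$ supported in $(0,1)$, independent of the Poisson process. Between loss times the capital of a household follows $dX_t=r[X_t-x^*]^+dt$, and at $\tau_i$ it is multiplied by $Z_i$. For $y\ge x^*$, the threshold strategy with threshold $y$ transfers the amount $y-X$ immediately whenever the capital $X$ is below $y$ (at time $0$ or right after a loss), and transfers nothing otherwise. Let $S_t$ be the cumulative transfers up to time $t$ and, for initial capital $x\geq 0$, let $$V_y(x)=\mathbb E\Big[\int_{0^-}^\infty e^{-\delta t}\,dS_t\Big].$$ Let $C:=V_{x^*}$ (the cost of social protection). For $x>y$ put $$\mathcal L^y(W)(x)=r(x-x^*)W'(x)-(\delta+\lambda)W(x)+\lambda\int_{(y/x,1]}W(xz)\,dG_Z(z)+\lambda\int_{(0,y/x]}\big((y-xz)+W(y)\big)\,dG_Z(z).$$ Proposition 4.2. Let $y\ge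 x^*$. Then $V_y$ is finite on $[0,\infty)$ and $$V_y(x)=\begin{cases}(y-x)+V_y(y), & 0\le x\le y,\\ W(x), & x>y,\end{cases}$$ where $W$ is the unique function on $[y,\infty)$ that is continuous on $[y,\infty)$, continuously differentiable on $(y,\infty)$, and satisfies $\mathcal L^y(W)(x)=0$ for all $x>y$, $W(y)=V_y(y)$ and $\lim_{x\to\infty}W(x)=0$ (in particular such a function exists). Moreover, in the case $y=x=x^*$, the value $C(x^*)=V_{x^*}(x^*)$ satisfies the equation in the following sense, without the derivative term: $$-(\delta+\lambda)C(x^*)+\lambda\int_0^1\big((x^*-x^*z)+C(x^*)\big)\,dG_Z(z)=0.$$ -/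

import Mathlib

open MeasureTheory ProbabilityTheory Set Filter Topology

namespace CashTransfer

/-- The random input of the model. `τ n` is the time of the `n`-th loss event (with `τ 0 = 0`) and
`Z n` is the proportion of capital that remains after the loss at time `τ (n + 1)`.
The losses occur at the arrival times of a Poisson process of intensity `lam` (the waiting times are
i.i.d. exponential), the proportions are i.i.d. with law `G` supported in `(0,1)`, and they are
independent of the Poisson process. That `τ` is strictly increasing and tends to infinity holds
almost surely and need not be required. -/
structure IsLossModel {Ω : Type*} [MeasurableSpace Ω] (P : Measure Ω) (lam : ℝ) (G : Measure ℝ)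
    (τ Z : ℕ → Ω → ℝ) : Prop where
  measurable_time : ∀ n, Measurable (τ n)
  measurable_prop : ∀ n, Measurable (Z n)
  time_zero : ∀ ω, τ 0 ω = 0
  gap_law : ∀ n, P.map (fun ω => τ (n + 1) ω - τ n ω) = expMeasure lam
  gap_indep : iIndepFun (fun n ω => τ (n + 1) ω - τ n ω) P
  prop_law : ∀ n, P.map (Z n) = G
  prop_indep : iIndepFun Z P
  prop_support : ∀ᵐ z ∂G, z ∈ Ioo (0 : ℝ) 1
  time_indep_prop : IndepFun (fun ω n => τ n ω) (fun ω n => Z n ω) P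

/-- Capital after a time `t` without loss events and without transfers, started from `x`:
exponential growth at rate `r` above the poverty line `xstar`, no growth below it. -/
noncomputable def flow (r xstar x t : ℝ) : ℝ :=
  if xstar < x then (x - xstar) * Real.exp (r * t) + xstar else x

/-- Capital right after the `n`-th loss event and the transfer (if any) made at that time, under the
strategy with threshold `y` and initial capital `x`. For `n = 0` it is the capital at time `0`, after
the initial transfer. -/
noncomputable def capitalAfter {Ω : Type*} (r xstar y : ℝ) (τ Z : ℕ → Ω → ℝ) (x : ℝ) :
    ℕ → Ω → ℝ
  | 0, _ => max x y
  | n + 1, ω =>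
      max (flow r xstar (capitalAfter r xstar y τ Z x n ω) (τ (n + 1) ω - τ n ω) * Z n ω) y

/-- The lump sum transferred at the loss time `τ (n + 1)`: the amount by which the capital right
after the loss falls short of the threshold `y`. -/
noncomputable def transfer {Ω : Type*} (r xstar y : ℝ) (τ Z : ℕ → Ω → ℝ) (x : ℝ)
    (n : ℕ) (ω : Ω) : ℝ :=
  max (y - flow r xstar (capitalAfter r xstar y τ Z x n ω) (τ (n + 1) ω - τ n ω) * Z n ω) 0

/-- The random measure `dS` on the time axis, where `S` is the cumulative transfer process of the
threshold strategy. Between loss events the capital does not decrease, so `S` jumps only at time `0`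
(by the initial shortfall) and at the loss times. -/
noncomputable def transferMeasure {Ω : Type*} (r xstar y : ℝ) (τ Z : ℕ → Ω → ℝ) (x : ℝ)
    (ω : Ω) : Measure ℝ :=
  ENNReal.ofReal (max (y - x) 0) • Measure.dirac 0 +
    Measure.sum fun n =>
      ENNReal.ofReal (transfer r xstar y τ Z x n ω) • Measure.dirac (τ (n + 1) ω)

/-- `E [∫_{0-}^∞ e^{-δ t} dS_t]` for the threshold strategy, as an extended non-negative number. -/
noncomputable def expectedCost {Ω : Type*} [MeasurableSpace Ω] (P : Measure Ω)
    (r δ xstar y : ℝ) (τ Z : ℕ → Ω → ℝ) (x : ℝ) : ENNReal :=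
  ∫⁻ ω, ∫⁻ t, ENNReal.ofReal (Real.exp (-δ * t)) ∂(transferMeasure r xstar y τ Z x ω) ∂P

/-- The value function `V_y` of the threshold strategy. -/
noncomputable def thresholdValue {Ω : Type*} [MeasurableSpace Ω] (P : Measure Ω)
    (r δ xstar y : ℝ) (τ Z : ℕ → Ω → ℝ) (x : ℝ) : ℝ :=
  (expectedCost P r δ xstar y τ Z x).toReal

/-- The cost of social protection `C`: the expected discounted sum of the injections that bring the
capital back to the poverty line `xstar` each time it falls below it. -/
noncomputable def socialProtectionCost {Ω : Type*} [MeasurableSpace Ω] (P : Measure Ω)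
    (r δ xstar : ℝ) (τ Z : ℕ → Ω → ℝ) (x : ℝ) : ℝ :=
  thresholdValue P r δ xstar xstar τ Z x

/-- The integro-differential operator `𝓛^y`. The integrals are over `(y/x, 1]` and `(0, y/x]`, so an
atom of `G` at `y/x` is counted once. -/
noncomputable def thresholdOperator (r δ lam xstar : ℝ) (G : Measure ℝ) (y : ℝ) (W : ℝ → ℝ)
    (x : ℝ) : ℝ :=
  r * (x - xstar) * deriv W x - (δ + lam) * W x
    + lam * (∫ z in (y / x)..1, W (x * z) ∂G)
    + lam * (∫ z in (0 : ℝ)..(y / x), ((y - x * z) + W y) ∂G)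

/-- `W` is a classical solution on `(y, ∞)` of `𝓛^y(W) = 0` with boundary values `W(y) = v` and
`W(∞) = 0`: it is continuous on `[y, ∞)` and continuously differentiable on `(y, ∞)`. Only the values
of `W` on `[y, ∞)` matter. -/
structure IsClassicalSolution (r δ lam xstar : ℝ) (G : Measure ℝ) (y v : ℝ) (W : ℝ → ℝ) : Prop where
  continuousOn : ContinuousOn W (Ici y)
  contDiffOn : ContDiffOn ℝ 1 W (Ioi y)
  equation : ∀ x, y < x → thresholdOperator r δ lam xstar G y W x = 0
  boundary : W y = v
  tendsto_zero : Tendsto W atTop (𝓝 0)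

end CashTransfer

/-!
The losses form a renewal structure: the waiting time and the proportion of the next loss are jointly
independent of the past (`IsLossModel.indepFun_past`). Hence the expected discounted value of a
function of the capital just before the `n`-th transfer is the `n`-th iterate of one operator `K`,
`lossOperator`, and the expected cost is `∑ Kⁿ p` with `p u = max (y - u) 0`
(`IsLossModel.expectedCost_eq_tsum`). All this is done with extended non-negative numbers, so that no
integrability is needed beforehand.

On functions on `[0, ∞)` the operator `K` contracts the supremum by `lam / (lam + δ) < 1`, the
Laplace transform of the waiting time at `δ`. It also preserves continuity and decay at infinity. Therefore
the series `V` converges to a bounded continuous function vanishing at infinity, and `V = p + K V`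
(`costSeries_eq`). Since `K V` is constant below the threshold, `V` is affine there.

Above the threshold, the capital in the coordinate `u` with `x - xstar = exp (r * u)` moves by
translation until the first loss, so `V = K V` exhibits `V` as the resolvent at `lam + δ` of the
translation semigroup, applied to the continuous function `lam * meanAfterLoss`. The
fundamental theorem of calculus then gives differentiability and the equation (`hasDerivAt_toReal_costSeries`), and the
affine form of `V` below `y` splits the mean after a loss into the two integrals of the operator. At
`x = xstar = y` the flow is at rest and `V = K V` is already the algebraic equation
(`costSeries_poverty_line`).

Uniqueness is a maximum principle for the difference of two solutions (`IsClassicalSolution.le`).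
-/

namespace CashTransfer

open scoped ENNReal

/-! ### Independence of the past from the next waiting time and proportion -/

/-- If two independent families, indexed by the same set, are jointly independent of each other,
then the family of pairs is independent. -/
lemma iIndepFun_prodMk {Ω : Type*} [MeasurableSpace Ω] {P : Measure Ω} {ι β γ : Type*}
    [mβ : MeasurableSpace β] [mγ : MeasurableSpace γ]
    [IsProbabilityMeasure P] {A : ι → Ω → β} {B : ι → Ω → γ} (hA : ∀ i, Measurable (A i))
    (hB : ∀ i, Measurable (B i)) (hAi : iIndepFun A P) (hBi : iIndepFun B P)
    (hAB : IndepFun (fun ω i => A i ω) (fun ω i => B i ω) P) :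
    iIndepFun (fun i ω => (A i ω, B i ω)) P := by
  rw [iIndepFun_iff_iIndep]
  let π : ι → Set (Set Ω) := fun i =>
    {u | ∃ t ∈ image2 (· ×ˢ ·) {s : Set β | MeasurableSet s} {t : Set γ | MeasurableSet t},
      (fun ω => (A i ω, B i ω)) ⁻¹' t = u}
  refine iIndepSets.iIndep (fun i => ((hA i).prodMk (hB i)).comap_le) π
    (fun i => isPiSystem_prod.comap _) (fun i => ?_) ?_
  · rw [← generateFrom_prod, MeasurableSpace.comap_generateFrom]
    rfl
  · rw [iIndepSets_iff]
    intro S f hf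
    have hf' : ∀ i, ∃ s : Set β, ∃ t : Set γ, MeasurableSet s ∧ MeasurableSet t ∧
        (i ∈ S → f i = A i ⁻¹' s ∩ B i ⁻¹' t) := by
      intro i
      by_cases hi : i ∈ S
      · obtain ⟨_, ⟨s, hs, t, ht, rfl⟩, h⟩ := hf i hi
        exact ⟨s, t, hs, ht, fun _ => by rw [← h]; rfl⟩
      · exact ⟨∅, ∅, .empty, .empty, fun h => (hi h).elim⟩
    choose s t hs ht hst using hf'
    have hprod : ∀ (s : ι → Set β) (t : ι → Set γ) (S : Finset ι), (∀ i, MeasurableSet (s i)) →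
        (∀ i, MeasurableSet (t i)) →
        P ((⋂ i ∈ S, A i ⁻¹' s i) ∩ ⋂ i ∈ S, B i ⁻¹' t i)
          = P (⋂ i ∈ S, A i ⁻¹' s i) * P (⋂ i ∈ S, B i ⁻¹' t i) := by
      intro s t S hs ht
      have h := hAB.measure_inter_preimage_eq_mul (⋂ i ∈ S, {a | a i ∈ s i})
        (⋂ i ∈ S, {b | b i ∈ t i})
        (S.measurableSet_biInter fun i _ => measurable_pi_apply i (hs i))
        (S.measurableSet_biInter fun i _ => measurable_pi_apply i (ht i))
      simp only [preimage_iInter] at h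
      exact h
    have h1 : (⋂ i ∈ S, f i) = (⋂ i ∈ S, A i ⁻¹' s i) ∩ ⋂ i ∈ S, B i ⁻¹' t i := by
      simp only [← iInter_inter_distrib]
      exact iInter₂_congr fun i hi => hst i hi
    rw [h1, hprod s t S hs ht, hAi.measure_inter_preimage_eq_mul S (fun i _ => hs i),
      hBi.measure_inter_preimage_eq_mul S (fun i _ => ht i), ← Finset.prod_mul_distrib]
    refine Finset.prod_congr rfl fun i hi => ?_
    rw [hst i hi]
    have := hprod s t {i} hs ht
    simpa using this.symm

lemma measurable_flow (r xstar : ℝ) : Measurable fun p : ℝ × ℝ => flow r xstar p.1 p.2 := by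
  unfold flow
  refine Measurable.ite (measurableSet_lt measurable_const measurable_fst) ?_ measurable_fst
  fun_prop

/-- Capital immediately before the transfer made at the `n`-th loss time (for `n = 0`: the initial
capital). -/
noncomputable def capitalBefore {Ω : Type*} (r xstar y : ℝ) (τ Z : ℕ → Ω → ℝ) (x : ℝ) : ℕ → Ω → ℝ
  | 0, _ => x
  | n + 1, ω =>
      flow r xstar (capitalAfter r xstar y τ Z x n ω) (τ (n + 1) ω - τ n ω) * Z n ω

lemma capitalAfter_eq {Ω : Type*} (r xstar y : ℝ) (τ Z : ℕ → Ω → ℝ) (x : ℝ) (n : ℕ) (ω : Ω) :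
    capitalAfter r xstar y τ Z x n ω = max (capitalBefore r xstar y τ Z x n ω) y := by
  cases n <;> rfl

lemma capitalBefore_succ {Ω : Type*} (r xstar y : ℝ) (τ Z : ℕ → Ω → ℝ) (x : ℝ) (n : ℕ) (ω : Ω) :
    capitalBefore r xstar y τ Z x (n + 1) ω =
      flow r xstar (max (capitalBefore r xstar y τ Z x n ω) y) (τ (n + 1) ω - τ n ω) * Z n ω := by
  rw [← capitalAfter_eq]
  rfl

/-- The transition operator of the capital before transfers, from one loss time to the next,
discounted over the waiting time: starting from `x` a transfer lifts the capital to `max x y`, and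
it then grows for an exponential time `p.1` and is multiplied by an independent proportion `p.2`. -/
noncomputable def lossOperator (r δ lam xstar y : ℝ) (G : Measure ℝ) (g : ℝ → ℝ≥0∞) (x : ℝ) :
    ℝ≥0∞ :=
  ∫⁻ p : ℝ × ℝ, ENNReal.ofReal (Real.exp (-δ * p.1)) * g (flow r xstar (max x y) p.1 * p.2)
    ∂((expMeasure lam).prod G)

variable {Ω : Type*} [MeasurableSpace Ω] {P : Measure Ω}

lemma IsLossModel.isProbabilityMeasure_prop [IsProbabilityMeasure P] {lam : ℝ} {G : Measure ℝ}
    {τ Z : ℕ → Ω → ℝ} (h : IsLossModel P lam G τ Z) : IsProbabilityMeasure G := by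
  rw [← h.prop_law 0]
  exact Measure.isProbabilityMeasure_map (h.measurable_prop 0).aemeasurable

lemma measurable_lossOperator {r δ lam xstar y : ℝ} {G : Measure ℝ} [SFinite G]
    [SFinite (expMeasure lam)] {g : ℝ → ℝ≥0∞} (hg : Measurable g) :
    Measurable (lossOperator r δ lam xstar y G g) := by
  unfold lossOperator
  refine Measurable.lintegral_prod_right' (f := fun q : ℝ × ℝ × ℝ =>
    ENNReal.ofReal (Real.exp (-δ * q.2.1)) * g (flow r xstar (max q.1 y) q.2.1 * q.2.2)) ?_
  have : Measurable fun q : ℝ × ℝ × ℝ => flow r xstar (max q.1 y) q.2.1 :=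
    (measurable_flow r xstar).comp ((measurable_fst.max measurable_const).prodMk
      measurable_snd.fst)
  have h2 := hg.comp (this.mul measurable_snd.snd)
  exact (by fun_prop : Measurable fun q : ℝ × ℝ × ℝ =>
    ENNReal.ofReal (Real.exp (-δ * q.2.1))).mul h2

lemma IsLossModel.measurable_capitalBefore {r lam xstar y : ℝ} {G : Measure ℝ}
    {τ Z : ℕ → Ω → ℝ} (h : IsLossModel P lam G τ Z) (x : ℝ) (n : ℕ) :
    Measurable (capitalBefore r xstar y τ Z x n) := by
  induction n with
  | zero => exact measurable_const
  | succ n ih =>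
    have : Measurable fun ω => flow r xstar (max (capitalBefore r xstar y τ Z x n ω) y)
        (τ (n + 1) ω - τ n ω) :=
      (measurable_flow r xstar).comp ((ih.max measurable_const).prodMk
        ((h.measurable_time _).sub (h.measurable_time _)))
    simp_rw [← capitalAfter_eq] at this
    exact this.mul (h.measurable_prop n)

namespace IsLossModel

variable [IsProbabilityMeasure P] {r δ lam xstar y : ℝ} {G : Measure ℝ} {τ Z : ℕ → Ω → ℝ}

lemma iIndepFun_pair (h : IsLossModel P lam G τ Z) :
    iIndepFun (fun n ω => (τ (n + 1) ω - τ n ω, Z n ω)) P := by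
  refine iIndepFun_prodMk (fun n => (h.measurable_time _).sub (h.measurable_time _))
    h.measurable_prop h.gap_indep h.prop_indep ?_
  exact h.time_indep_prop.comp (φ := fun (s : ℕ → ℝ) n => s (n + 1) - s n) (ψ := id)
    (by fun_prop) measurable_id

/-- The loss time and the capital before the `n`-th transfer depend only on the first `n` waiting times
and proportions, hence are independent of the next ones. -/
lemma indepFun_past (h : IsLossModel P lam G τ Z) (x : ℝ) (n : ℕ) :
    IndepFun (fun ω => (τ n ω, capitalBefore r xstar y τ Z x n ω))
      (fun ω => (τ (n + 1) ω - τ n ω, Z n ω)) P := by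
  let m : ℕ → MeasurableSpace Ω := fun k =>
    MeasurableSpace.comap (fun ω => (τ (k + 1) ω - τ k ω, Z k ω)) inferInstance
  let ℱ : ℕ → MeasurableSpace Ω := fun n => ⨆ i ∈ Iio n, m i
  have hpair : ∀ k n, k < n → Measurable[ℱ n] fun ω => (τ (k + 1) ω - τ k ω, Z k ω) := by
    intro k n hk
    have hle : m k ≤ ℱ n := le_iSup₂_of_le (f := fun i (_ : i ∈ Iio n) => m i) k hk le_rfl
    exact (comap_measurable _).mono hle le_rfl
  have hmono : ∀ n, ℱ n ≤ ℱ (n + 1) := fun n =>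
    biSup_mono fun i (hi : i < n) => Nat.lt_succ_of_lt hi
  have hpast : ∀ n, Measurable[ℱ n] fun ω => (τ n ω, capitalBefore r xstar y τ Z x n ω) := by
    intro n
    induction n with
    | zero =>
      have : (fun ω => (τ 0 ω, capitalBefore r xstar y τ Z x 0 ω)) = fun _ => (0, x) := by
        funext ω
        simp [h.time_zero, capitalBefore]
      rw [this]
      exact @measurable_const _ _ _ (ℱ 0) _
    | succ n ih =>
      have h1 := (ih.mono (hmono n) le_rfl).prodMk (hpair n (n + 1) (Nat.lt_succ_self n))
      have h2 : Measurable fun q : (ℝ × ℝ) × ℝ × ℝ =>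
          (q.1.1 + q.2.1, flow r xstar (max q.1.2 y) q.2.1 * q.2.2) := by
        refine Measurable.prodMk (by fun_prop) (Measurable.mul ?_ (by fun_prop))
        exact (measurable_flow r xstar).comp (f := fun q : (ℝ × ℝ) × ℝ × ℝ =>
          (max q.1.2 y, q.2.1)) (by fun_prop)
      have h3 := h2.comp h1
      convert! h3 using 1
      funext ω
      simp only [capitalBefore_succ, Function.comp_apply, add_sub_cancel]
  have hm : ∀ k, m k ≤ ‹MeasurableSpace Ω› := fun k =>
    (((h.measurable_time _).sub (h.measurable_time _)).prodMk (h.measurable_prop k)).comap_le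
  have hind : Indep (ℱ n) (⨆ i ∈ ({n} : Set ℕ), m i) P :=
    indep_iSup_of_disjoint hm h.iIndepFun_pair (by simp)
  rw [iSup_singleton] at hind
  rw [IndepFun_iff_Indep]
  exact indep_of_indep_of_le_left hind (hpast n).comap_le

lemma map_pair (h : IsLossModel P lam G τ Z) (n : ℕ) :
    P.map (fun ω => (τ (n + 1) ω - τ n ω, Z n ω)) = (expMeasure lam).prod G := by
  have hi : IndepFun (fun ω => τ (n + 1) ω - τ n ω) (Z n) P :=
    h.time_indep_prop.comp (φ := fun s : ℕ → ℝ => s (n + 1) - s n) (ψ := fun s : ℕ → ℝ => s n)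
      (by fun_prop) (by fun_prop)
  have hgap : Measurable fun ω => τ (n + 1) ω - τ n ω :=
    (h.measurable_time _).sub (h.measurable_time _)
  rw [(indepFun_iff_map_prod_eq_prod_map_map hgap.aemeasurable
    (h.measurable_prop n).aemeasurable).1 hi, h.gap_law, h.prop_law]

/-! ### The expected cost as a series of iterates of the loss operator -/

/-- Markov property at the loss times: the discounted expectation of a function of the capital
before the `n`-th transfer is an iterate of the loss operator. -/
lemma lintegral_capitalBefore (h : IsLossModel P lam G τ Z) (hlam : 0 < lam) (x : ℝ) (n : ℕ) :
    ∀ g : ℝ → ℝ≥0∞, Measurable g →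
    ∫⁻ ω, ENNReal.ofReal (Real.exp (-δ * τ n ω)) * g (capitalBefore r xstar y τ Z x n ω) ∂P
      = (lossOperator r δ lam xstar y G)^[n] g x := by
  have := h.isProbabilityMeasure_prop
  have := isProbabilityMeasure_expMeasure hlam
  induction n with
  | zero => intro g _; simp [capitalBefore, h.time_zero]
  | succ n ih =>
    intro g hg
    rw [Function.iterate_succ_apply, ← ih _ (measurable_lossOperator hg)]
    have hS : Measurable fun ω => (τ n ω, capitalBefore r xstar y τ Z x n ω) :=
      (h.measurable_time n).prodMk (h.measurable_capitalBefore x n)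
    have hT : Measurable fun ω => (τ (n + 1) ω - τ n ω, Z n ω) :=
      ((h.measurable_time _).sub (h.measurable_time _)).prodMk (h.measurable_prop n)
    have hlaw := (indepFun_iff_map_prod_eq_prod_map_map hS.aemeasurable hT.aemeasurable).1
      (h.indepFun_past (r := r) (xstar := xstar) (y := y) x n)
    rw [h.map_pair] at hlaw
    have hflow : Measurable fun q : (ℝ × ℝ) × ℝ × ℝ => flow r xstar (max q.1.2 y) q.2.1 :=
      (measurable_flow r xstar).comp (f := fun q : (ℝ × ℝ) × ℝ × ℝ => (max q.1.2 y, q.2.1))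
        (by fun_prop)
    let F : (ℝ × ℝ) × ℝ × ℝ → ℝ≥0∞ := fun q => ENNReal.ofReal (Real.exp (-δ * q.1.1)) *
      (ENNReal.ofReal (Real.exp (-δ * q.2.1)) * g (flow r xstar (max q.1.2 y) q.2.1 * q.2.2))
    have hF : Measurable F := by
      have h1 := hg.comp (hflow.mul (by fun_prop : Measurable fun q : (ℝ × ℝ) × ℝ × ℝ => q.2.2))
      exact Measurable.mul (by fun_prop) (Measurable.mul (by fun_prop) h1)
    calc _ = ∫⁻ ω, F ((τ n ω, capitalBefore r xstar y τ Z x n ω),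
          (τ (n + 1) ω - τ n ω, Z n ω)) ∂P := by
          refine lintegral_congr fun ω => ?_
          simp only [F, capitalBefore_succ]
          rw [← mul_assoc, ← ENNReal.ofReal_mul (Real.exp_pos _).le, ← Real.exp_add]
          congr 4
          ring
      _ = ∫⁻ s, ∫⁻ t, F (s, t) ∂((expMeasure lam).prod G)
            ∂(P.map fun ω => (τ n ω, capitalBefore r xstar y τ Z x n ω)) := by
          rw [← lintegral_prod _ hF.aemeasurable, ← hlaw, lintegral_map hF (hS.prodMk hT)]
      _ = _ := by
          rw [lintegral_map hF.lintegral_prod_right' hS]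
          refine lintegral_congr fun ω => ?_
          simp only [F, lossOperator]
          rw [lintegral_const_mul']
          exact ENNReal.ofReal_ne_top

/-- The expected cost as the series, over the loss times, of discounted expected transfers. -/
lemma expectedCost_eq_tsum (h : IsLossModel P lam G τ Z) (hlam : 0 < lam) (x : ℝ) :
    expectedCost P r δ xstar y τ Z x
      = ∑' n, (lossOperator r δ lam xstar y G)^[n] (fun u => ENNReal.ofReal (max (y - u) 0)) x := by
  have hp : Measurable fun u : ℝ => ENNReal.ofReal (max (y - u) 0) := by fun_prop
  simp_rw [← h.lintegral_capitalBefore hlam x _ _ hp]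
  rw [← lintegral_tsum fun n => ?_]
  · refine lintegral_congr fun ω => ?_
    rw [tsum_eq_zero_add' ENNReal.summable, transferMeasure, lintegral_add_measure,
      lintegral_smul_measure, lintegral_dirac, lintegral_sum_measure, h.time_zero]
    congr 1
    · simp [capitalBefore]
    · refine tsum_congr fun n => ?_
      rw [lintegral_smul_measure, lintegral_dirac, smul_eq_mul, mul_comm]
      rfl
  · have h1 := hp.comp (h.measurable_capitalBefore (r := r) (xstar := xstar) (y := y) x n)
    have h2 := h.measurable_time n
    exact (Measurable.mul (by fun_prop) h1).aemeasurable

end IsLossModel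

/-! ### The loss operator: contraction, continuity and decay at infinity -/

lemma flow_of_le {xstar x : ℝ} (r t : ℝ) (hx : xstar ≤ x) :
    flow r xstar x t = (x - xstar) * Real.exp (r * t) + xstar := by
  rcases hx.lt_or_eq with h | rfl
  · simp [flow, h]
  · simp [flow]

lemma lintegral_expMeasure {lam : ℝ} {f : ℝ → ℝ≥0∞} :
    ∫⁻ t, f t ∂(expMeasure lam) = ∫⁻ t, exponentialPDF lam t * f t := by
  have : Measurable (exponentialPDF lam) := (measurable_exponentialPDFReal lam).ennreal_ofReal
  exact lintegral_withDensity_eq_lintegral_mul_non_measurable _ this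
    (ae_of_all _ fun _ => ENNReal.ofReal_lt_top) _

lemma ae_expMeasure_nonneg (lam : ℝ) : ∀ᵐ t ∂(expMeasure lam), 0 ≤ t := by
  have : Measurable (exponentialPDF lam) := (measurable_exponentialPDFReal lam).ennreal_ofReal
  refine (ae_withDensity_iff this).2 (ae_of_all _ fun t ht => ?_)
  by_contra hneg
  exact ht (exponentialPDF_of_neg (not_le.1 hneg))

/-- The Laplace transform of the exponential distribution, read off from the fact that the
exponential density with rate `lam + δ` has total mass one. -/
lemma lintegral_exp_expMeasure {lam δ : ℝ} (hlam : 0 < lam) (hδ : 0 < δ) :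
    ∫⁻ t, ENNReal.ofReal (Real.exp (-δ * t)) ∂(expMeasure lam)
      = ENNReal.ofReal (lam / (lam + δ)) := by
  have hs : 0 < lam + δ := add_pos hlam hδ
  have hm : Measurable (exponentialPDF (lam + δ)) :=
    (measurable_exponentialPDFReal _).ennreal_ofReal
  rw [lintegral_expMeasure]
  calc _ = ∫⁻ t, ENNReal.ofReal (lam / (lam + δ)) * exponentialPDF (lam + δ) t := by
        refine lintegral_congr fun t => ?_
        rcases lt_or_ge t 0 with ht | ht
        · simp [exponentialPDF_of_neg ht]
        · rw [exponentialPDF_of_nonneg ht, exponentialPDF_of_nonneg ht,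
            ← ENNReal.ofReal_mul (by positivity), ← ENNReal.ofReal_mul (by positivity)]
          congr 1
          rw [mul_assoc, ← Real.exp_add, ← mul_assoc, div_mul_cancel₀ _ hs.ne']
          congr 2
          ring
    _ = _ := by rw [lintegral_const_mul _ hm, lintegral_exponentialPDF_eq_one hs, mul_one]

lemma ae_prod_mem {lam : ℝ} {G : Measure ℝ} [SFinite G] (hlam : 0 < lam) (hG : ∀ᵐ z ∂G, z ∈ Ioo (0 : ℝ) 1) :
    ∀ᵐ p ∂((expMeasure lam).prod G), 0 ≤ p.1 ∧ p.2 ∈ Ioo (0 : ℝ) 1 := by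
  have := isProbabilityMeasure_expMeasure hlam
  exact (Measure.quasiMeasurePreserving_fst.ae (ae_expMeasure_nonneg lam)).and
    (Measure.quasiMeasurePreserving_snd.ae hG)

section LossOperator

variable {r δ lam xstar y : ℝ} {G : Measure ℝ} [IsProbabilityMeasure G]

lemma flow_max_nonneg (hxstar : 0 ≤ xstar) (hy : xstar ≤ y) (x t : ℝ) :
    0 ≤ flow r xstar (max x y) t := by
  have hm : xstar ≤ max x y := hy.trans (le_max_right x y)
  rw [flow_of_le r t hm]
  have := mul_nonneg (sub_nonneg.2 hm) (Real.exp_pos (r * t)).le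
  linarith

lemma lossOperator_integrand_le (hlam : 0 < lam) (hG : ∀ᵐ z ∂G, z ∈ Ioo (0 : ℝ) 1)
    (hxstar : 0 ≤ xstar) (hy : xstar ≤ y) {g : ℝ → ℝ≥0∞} {c : ℝ≥0∞} (hg : ∀ x, 0 ≤ x → g x ≤ c)
    (x : ℝ) :
    ∀ᵐ p ∂((expMeasure lam).prod G),
      ENNReal.ofReal (Real.exp (-δ * p.1)) * g (flow r xstar (max x y) p.1 * p.2)
        ≤ ENNReal.ofReal (Real.exp (-δ * p.1)) * c := by
  filter_upwards [ae_prod_mem hlam hG] with p hp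
  gcongr
  exact hg _ (mul_nonneg (flow_max_nonneg hxstar hy _ _) hp.2.1.le)

lemma lintegral_prod_exp_mul_const (hlam : 0 < lam) (hδ : 0 < δ) (c : ℝ≥0∞) :
    ∫⁻ p : ℝ × ℝ, ENNReal.ofReal (Real.exp (-δ * p.1)) * c ∂((expMeasure lam).prod G)
      = ENNReal.ofReal (lam / (lam + δ)) * c := by
  have := isProbabilityMeasure_expMeasure hlam
  rw [lintegral_prod _ (by fun_prop)]
  simp only [lintegral_const, measure_univ, mul_one]
  rw [lintegral_mul_const _ (by fun_prop), lintegral_exp_expMeasure hlam hδ]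

/-- The loss operator contracts the supremum over `[0, ∞)` by `lam / (lam + δ) < 1`. -/
lemma lossOperator_le (hlam : 0 < lam) (hδ : 0 < δ) (hG : ∀ᵐ z ∂G, z ∈ Ioo (0 : ℝ) 1)
    (hxstar : 0 ≤ xstar) (hy : xstar ≤ y) {g : ℝ → ℝ≥0∞} {c : ℝ≥0∞} (hg : ∀ x, 0 ≤ x → g x ≤ c)
    (x : ℝ) :
    lossOperator r δ lam xstar y G g x ≤ ENNReal.ofReal (lam / (lam + δ)) * c :=
  (lintegral_mono_ae (lossOperator_integrand_le hlam hG hxstar hy hg x)).trans_eq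
    (lintegral_prod_exp_mul_const hlam hδ c)

/-- Dominated convergence for the loss operator. -/
lemma tendsto_lossOperator (hlam : 0 < lam) (hδ : 0 < δ) (hG : ∀ᵐ z ∂G, z ∈ Ioo (0 : ℝ) 1)
    (hxstar : 0 ≤ xstar) (hy : xstar ≤ y) {g : ℝ → ℝ≥0∞} {c : ℝ≥0∞} (hg : ∀ x, 0 ≤ x → g x ≤ c)
    (hgm : Measurable g) (hc : c ≠ ∞) {l : Filter ℝ} [l.IsCountablyGenerated]
    {f : ℝ × ℝ → ℝ≥0∞} (hf : ∀ t z, z ∈ Ioo (0 : ℝ) 1 →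
      Tendsto (fun x => g (flow r xstar (max x y) t * z)) l (𝓝 (f (t, z)))) :
    Tendsto (lossOperator r δ lam xstar y G g) l
      (𝓝 (∫⁻ p : ℝ × ℝ, ENNReal.ofReal (Real.exp (-δ * p.1)) * f p ∂((expMeasure lam).prod G))) := by
  refine tendsto_lintegral_filter_of_dominated_convergence _ ?_
    (Eventually.of_forall fun x => lossOperator_integrand_le hlam hG hxstar hy hg x) ?_ ?_
  · refine Eventually.of_forall fun x => ?_
    have h1 : Measurable fun p : ℝ × ℝ => flow r xstar (max x y) p.1 :=
      (measurable_flow r xstar).comp (measurable_const.prodMk measurable_fst)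
    exact Measurable.mul (by fun_prop) (hgm.comp (h1.mul measurable_snd))
  · rw [lintegral_prod_exp_mul_const hlam hδ]
    exact ENNReal.mul_ne_top ENNReal.ofReal_ne_top hc
  · filter_upwards [ae_prod_mem hlam hG] with p hp
    exact ENNReal.Tendsto.const_mul (hf p.1 p.2 hp.2) (Or.inr ENNReal.ofReal_ne_top)

lemma continuous_lossOperator (hlam : 0 < lam) (hδ : 0 < δ) (hG : ∀ᵐ z ∂G, z ∈ Ioo (0 : ℝ) 1)
    (hxstar : 0 ≤ xstar) (hy : xstar ≤ y) {g : ℝ → ℝ≥0∞} {c : ℝ≥0∞} (hg : ∀ x, 0 ≤ x → g x ≤ c)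
    (hgm : Measurable g) (hc : c ≠ ∞) (hgc : ContinuousOn g (Ici 0)) :
    Continuous (lossOperator r δ lam xstar y G g) := by
  refine continuous_iff_continuousAt.2 fun x =>
    tendsto_lossOperator (f := fun p => g (flow r xstar (max x y) p.1 * p.2))
      hlam hδ hG hxstar hy hg hgm hc fun t z hz => ?_
  have hcont : Continuous fun x => flow r xstar (max x y) t * z := by
    have : ∀ x, flow r xstar (max x y) t = (max x y - xstar) * Real.exp (r * t) + xstar :=
      fun x => flow_of_le r t (hy.trans (le_max_right x y))
    simp_rw [this]
    fun_prop
  exact (hgc.comp_continuous hcont fun x =>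
    mul_nonneg (flow_max_nonneg hxstar hy _ _) hz.1.le).tendsto x

lemma tendsto_lossOperator_atTop (hlam : 0 < lam) (hδ : 0 < δ)
    (hG : ∀ᵐ z ∂G, z ∈ Ioo (0 : ℝ) 1)
    (hxstar : 0 ≤ xstar) (hy : xstar ≤ y) {g : ℝ → ℝ≥0∞} {c : ℝ≥0∞} (hg : ∀ x, 0 ≤ x → g x ≤ c)
    (hgm : Measurable g) (hc : c ≠ ∞) (hg0 : Tendsto g atTop (𝓝 0)) :
    Tendsto (lossOperator r δ lam xstar y G g) atTop (𝓝 0) := by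
  have h := tendsto_lossOperator (r := r) (f := fun _ => 0) (l := atTop)
    hlam hδ hG hxstar hy hg hgm hc fun t z hz => ?_
  · simpa using h
  · -- Until the next loss the capital grows at least linearly in `x`, and `z > 0`.
    refine hg0.comp (Tendsto.atTop_mul_const hz.1 ?_)
    have h1 : Tendsto (fun x => (x - xstar) * Real.exp (r * t) + xstar) atTop atTop :=
      tendsto_atTop_add_const_right _ _
        ((tendsto_atTop_add_const_right _ _ tendsto_id).atTop_mul_const (Real.exp_pos _))
    refine tendsto_atTop_mono (fun x => ?_) h1
    rw [flow_of_le r t (hy.trans (le_max_right x y))]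
    gcongr
    exact le_max_left x y

/-! ### The cost series and dynamic programming -/

variable (r δ lam xstar y G) in
/-- The value of the threshold strategy as a function of the initial capital, written through the
loss operator: the `n`-th term is the expected discounted transfer at the `n`-th loss time (for `n = 0`: at time
`0`). -/
noncomputable def costSeries (x : ℝ) : ℝ≥0∞ :=
  ∑' n, (lossOperator r δ lam xstar y G)^[n] (fun u => ENNReal.ofReal (max (y - u) 0)) x

/-- The properties of the `n`-th term of the cost series that pass to the sum. -/
lemma iterate_lossOperator_properties (hlam : 0 < lam) (hδ : 0 < δ)
    (hG : ∀ᵐ z ∂G, z ∈ Ioo (0 : ℝ) 1) (hxstar : 0 ≤ xstar) (hy : xstar ≤ y) (n : ℕ) :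
    let g := (lossOperator r δ lam xstar y G)^[n] (fun u => ENNReal.ofReal (max (y - u) 0))
    Measurable g ∧ (∀ x, 0 ≤ x → g x ≤ ENNReal.ofReal (lam / (lam + δ)) ^ n * ENNReal.ofReal y) ∧
      ContinuousOn g (Ici 0) ∧ Tendsto g atTop (𝓝 0) := by
  have := isProbabilityMeasure_expMeasure hlam
  induction n with
  | zero =>
    refine ⟨by simp only [Function.iterate_zero, id]; fun_prop, fun x hx => ?_, ?_, ?_⟩
    · simp only [Function.iterate_zero, id, pow_zero, one_mul]
      exact ENNReal.ofReal_le_ofReal (max_le (by linarith) (hxstar.trans hy))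
    · simp only [Function.iterate_zero, id]
      exact (ENNReal.continuous_ofReal.comp (by fun_prop)).continuousOn
    · refine tendsto_const_nhds.congr' ?_
      filter_upwards [eventually_ge_atTop y] with x hx
      simp [hx]
  | succ n ih =>
    obtain ⟨h1, h2, h3, h4⟩ := ih
    have hc : ENNReal.ofReal (lam / (lam + δ)) ^ n * ENNReal.ofReal y ≠ ∞ :=
      ENNReal.mul_ne_top (ENNReal.pow_ne_top ENNReal.ofReal_ne_top) ENNReal.ofReal_ne_top
    simp only [Function.iterate_succ_apply']
    refine ⟨measurable_lossOperator h1, fun x _ => ?_,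
      (continuous_lossOperator hlam hδ hG hxstar hy h2 h1 hc h3).continuousOn,
      tendsto_lossOperator_atTop hlam hδ hG hxstar hy h2 h1 hc h4⟩
    rw [pow_succ', mul_assoc]
    exact lossOperator_le hlam hδ hG hxstar hy h2 x

lemma tsum_geometric_mul_ne_top (hlam : 0 < lam) (hδ : 0 < δ) (y : ℝ) :
    ∑' n : ℕ, ENNReal.ofReal (lam / (lam + δ)) ^ n * ENNReal.ofReal y ≠ ∞ := by
  rw [ENNReal.tsum_mul_right, ENNReal.tsum_geometric]
  refine ENNReal.mul_ne_top (ENNReal.inv_ne_top.2 (tsub_pos_of_lt ?_).ne') ENNReal.ofReal_ne_top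
  rw [ENNReal.ofReal_lt_one, div_lt_one (by positivity)]
  linarith

lemma costSeries_le (hlam : 0 < lam) (hδ : 0 < δ) (hG : ∀ᵐ z ∂G, z ∈ Ioo (0 : ℝ) 1)
    (hxstar : 0 ≤ xstar) (hy : xstar ≤ y) {x : ℝ} (hx : 0 ≤ x) :
    costSeries r δ lam xstar y G x
      ≤ ∑' n : ℕ, ENNReal.ofReal (lam / (lam + δ)) ^ n * ENNReal.ofReal y :=
  ENNReal.tsum_le_tsum fun n =>
    (iterate_lossOperator_properties hlam hδ hG hxstar hy n).2.1 x hx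

lemma costSeries_ne_top (hlam : 0 < lam) (hδ : 0 < δ) (hG : ∀ᵐ z ∂G, z ∈ Ioo (0 : ℝ) 1)
    (hxstar : 0 ≤ xstar) (hy : xstar ≤ y) {x : ℝ} (hx : 0 ≤ x) :
    costSeries r δ lam xstar y G x ≠ ∞ :=
  ne_top_of_le_ne_top (tsum_geometric_mul_ne_top hlam hδ y)
    (costSeries_le hlam hδ hG hxstar hy hx)

lemma measurable_costSeries (hlam : 0 < lam) (hδ : 0 < δ) (hG : ∀ᵐ z ∂G, z ∈ Ioo (0 : ℝ) 1)
    (hxstar : 0 ≤ xstar) (hy : xstar ≤ y) : Measurable (costSeries r δ lam xstar y G) :=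
  Measurable.tsum fun n => (iterate_lossOperator_properties hlam hδ hG hxstar hy n).1

/-- Dominated convergence for the cost series, seen as an integral for the counting measure. -/
lemma tendsto_costSeries (hlam : 0 < lam) (hδ : 0 < δ) (hG : ∀ᵐ z ∂G, z ∈ Ioo (0 : ℝ) 1)
    (hxstar : 0 ≤ xstar) (hy : xstar ≤ y) {l : Filter ℝ} [l.IsCountablyGenerated]
    (hl : ∀ᶠ x in l, 0 ≤ x) {f : ℕ → ℝ≥0∞}
    (hf : ∀ n, Tendsto ((lossOperator r δ lam xstar y G)^[n]
      (fun u => ENNReal.ofReal (max (y - u) 0))) l (𝓝 (f n))) :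
    Tendsto (costSeries r δ lam xstar y G) l (𝓝 (∑' n, f n)) := by
  unfold costSeries
  simp_rw [← lintegral_count]
  refine tendsto_lintegral_filter_of_dominated_convergence
    (fun n : ℕ => ENNReal.ofReal (lam / (lam + δ)) ^ n * ENNReal.ofReal y)
    (Eventually.of_forall fun x => measurable_from_nat) ?_ ?_ (ae_of_all _ hf)
  · filter_upwards [hl] with x hx
    exact ae_of_all _ fun n => (iterate_lossOperator_properties hlam hδ hG hxstar hy n).2.1 x hx
  · rw [lintegral_count]
    exact tsum_geometric_mul_ne_top hlam hδ y

lemma continuousOn_costSeries (hlam : 0 < lam) (hδ : 0 < δ) (hG : ∀ᵐ z ∂G, z ∈ Ioo (0 : ℝ) 1)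
    (hxstar : 0 ≤ xstar) (hy : xstar ≤ y) :
    ContinuousOn (costSeries r δ lam xstar y G) (Ici 0) := fun x hx =>
  tendsto_costSeries hlam hδ hG hxstar hy self_mem_nhdsWithin fun n =>
    (iterate_lossOperator_properties hlam hδ hG hxstar hy n).2.2.1 x hx

lemma tendsto_costSeries_atTop (hlam : 0 < lam) (hδ : 0 < δ) (hG : ∀ᵐ z ∂G, z ∈ Ioo (0 : ℝ) 1)
    (hxstar : 0 ≤ xstar) (hy : xstar ≤ y) :
    Tendsto (costSeries r δ lam xstar y G) atTop (𝓝 0) := by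
  have := tendsto_costSeries (r := r) (f := fun _ => 0) hlam hδ hG hxstar hy
    (eventually_ge_atTop 0) fun n =>
      (iterate_lossOperator_properties hlam hδ hG hxstar hy n).2.2.2
  simpa using this

/-- Dynamic programming at the first loss time. -/
lemma costSeries_eq (hlam : 0 < lam) (hδ : 0 < δ) (hG : ∀ᵐ z ∂G, z ∈ Ioo (0 : ℝ) 1)
    (hxstar : 0 ≤ xstar) (hy : xstar ≤ y) (x : ℝ) :
    costSeries r δ lam xstar y G x = ENNReal.ofReal (max (y - x) 0)
      + lossOperator r δ lam xstar y G (costSeries r δ lam xstar y G) x := by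
  rw [costSeries, tsum_eq_zero_add' ENNReal.summable]
  congr 1
  simp only [lossOperator, costSeries, ← ENNReal.tsum_mul_left]
  rw [lintegral_tsum fun n => ?_]
  · simp only [Function.iterate_succ_apply', lossOperator]
  · have h1 : Measurable fun p : ℝ × ℝ => flow r xstar (max x y) p.1 :=
      (measurable_flow r xstar).comp (measurable_const.prodMk measurable_fst)
    exact (Measurable.mul (by fun_prop)
      ((iterate_lossOperator_properties hlam hδ hG hxstar hy n).1.comp
        (h1.mul measurable_snd))).aemeasurable

/-! ### The value function as a real-valued function -/

lemma continuousOn_toReal_costSeries (hlam : 0 < lam) (hδ : 0 < δ)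
    (hG : ∀ᵐ z ∂G, z ∈ Ioo (0 : ℝ) 1) (hxstar : 0 ≤ xstar) (hy : xstar ≤ y) :
    ContinuousOn (fun x => (costSeries r δ lam xstar y G x).toReal) (Ici 0) := fun x hx =>
  (ENNReal.tendsto_toReal (costSeries_ne_top hlam hδ hG hxstar hy hx)).comp
    (continuousOn_costSeries hlam hδ hG hxstar hy x hx)

lemma tendsto_toReal_costSeries (hlam : 0 < lam) (hδ : 0 < δ)
    (hG : ∀ᵐ z ∂G, z ∈ Ioo (0 : ℝ) 1) (hxstar : 0 ≤ xstar) (hy : xstar ≤ y) :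
    Tendsto (fun x => (costSeries r δ lam xstar y G x).toReal) atTop (𝓝 0) :=
  (ENNReal.tendsto_toReal ENNReal.zero_ne_top).comp
    (tendsto_costSeries_atTop hlam hδ hG hxstar hy)

lemma exists_toReal_costSeries_le (hlam : 0 < lam) (hδ : 0 < δ)
    (hG : ∀ᵐ z ∂G, z ∈ Ioo (0 : ℝ) 1) (hxstar : 0 ≤ xstar) (hy : xstar ≤ y) :
    ∃ B, ∀ x, 0 ≤ x → (costSeries r δ lam xstar y G x).toReal ≤ B :=
  ⟨_, fun _ hx => ENNReal.toReal_mono (tsum_geometric_mul_ne_top hlam hδ y)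
    (costSeries_le hlam hδ hG hxstar hy hx)⟩

lemma toReal_costSeries_of_le (hlam : 0 < lam) (hδ : 0 < δ)
    (hG : ∀ᵐ z ∂G, z ∈ Ioo (0 : ℝ) 1) (hxstar : 0 ≤ xstar) (hy : xstar ≤ y) {x : ℝ}
    (hx : x ≤ y) :
    (costSeries r δ lam xstar y G x).toReal
      = (y - x) + (costSeries r δ lam xstar y G y).toReal := by
  have hfin := costSeries_ne_top (r := r) hlam hδ hG hxstar hy (hxstar.trans hy)
  have h1 : costSeries r δ lam xstar y G x
      = ENNReal.ofReal (y - x) + costSeries r δ lam xstar y G y := by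
    rw [costSeries_eq hlam hδ hG hxstar hy x, costSeries_eq hlam hδ hG hxstar hy y]
    simp [lossOperator, hx]
  rw [h1, ENNReal.toReal_add ENNReal.ofReal_ne_top hfin, ENNReal.toReal_ofReal (sub_nonneg.2 hx)]

/-- Dynamic programming above the threshold, for the real-valued value function. -/
lemma toReal_costSeries_eq_integral (hlam : 0 < lam) (hδ : 0 < δ)
    (hG : ∀ᵐ z ∂G, z ∈ Ioo (0 : ℝ) 1) (hxstar : 0 ≤ xstar) (hy : xstar ≤ y) {x : ℝ}
    (hx : y ≤ x) :
    (costSeries r δ lam xstar y G x).toReal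
      = ∫ t, Real.exp (-δ * t) * ∫ z, (costSeries r δ lam xstar y G
          (((x - xstar) * Real.exp (r * t) + xstar) * z)).toReal ∂G ∂(expMeasure lam) := by
  have := isProbabilityMeasure_expMeasure hlam
  set V : ℝ → ℝ := fun x => (costSeries r δ lam xstar y G x).toReal with hV
  have hVm : Measurable V := (measurable_costSeries hlam hδ hG hxstar hy).ennreal_toReal
  have hVm2 : Measurable fun p : ℝ × ℝ =>
      V (((x - xstar) * Real.exp (r * p.1) + xstar) * p.2) := hVm.comp (by fun_prop)
  have hFm : Measurable fun p : ℝ × ℝ => Real.exp (-δ * p.1) *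
      V (((x - xstar) * Real.exp (r * p.1) + xstar) * p.2) :=
    Measurable.mul (by fun_prop) hVm2
  have harg : ∀ t z : ℝ, 0 ≤ z → 0 ≤ ((x - xstar) * Real.exp (r * t) + xstar) * z := by
    intro t z hz
    have := mul_nonneg (sub_nonneg.2 (hy.trans hx)) (Real.exp_pos (r * t)).le
    exact mul_nonneg (by linarith) hz
  obtain ⟨B, hB⟩ := exists_toReal_costSeries_le (r := r) hlam hδ hG hxstar hy
  have hint : Integrable (fun p : ℝ × ℝ => Real.exp (-δ * p.1) *
      V (((x - xstar) * Real.exp (r * p.1) + xstar) * p.2)) ((expMeasure lam).prod G) := by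
    refine Integrable.of_bound hFm.aestronglyMeasurable B ?_
    filter_upwards [ae_prod_mem hlam hG] with p hp
    have h0 : 0 ≤ V (((x - xstar) * Real.exp (r * p.1) + xstar) * p.2) := ENNReal.toReal_nonneg
    rw [Real.norm_of_nonneg (mul_nonneg (Real.exp_pos _).le h0)]
    have h1 : Real.exp (-δ * p.1) ≤ 1 := Real.exp_le_one_iff.2 (by nlinarith [hp.1])
    exact (mul_le_of_le_one_left h0 h1).trans (hB _ (harg _ _ hp.2.1.le))
  simp_rw [← integral_const_mul]
  rw [← integral_prod _ hint, integral_eq_lintegral_of_nonneg_ae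
    (ae_of_all _ fun p => mul_nonneg (Real.exp_pos _).le ENNReal.toReal_nonneg)
    hFm.aestronglyMeasurable]
  change (costSeries r δ lam xstar y G x).toReal = _
  congr 1
  rw [costSeries_eq hlam hδ hG hxstar hy x]
  simp only [sub_nonpos.2 hx, max_eq_right, ENNReal.ofReal_zero, zero_add, lossOperator]
  refine lintegral_congr_ae ?_
  filter_upwards [ae_prod_mem hlam hG] with p hp
  rw [max_eq_left hx, flow_of_le r _ (hy.trans hx), ENNReal.ofReal_mul (Real.exp_pos _).le,
    ENNReal.ofReal_toReal (costSeries_ne_top hlam hδ hG hxstar hy (harg _ _ hp.2.1.le))]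

end LossOperator

/-! ### The integro-differential equation -/

lemma integral_expMeasure {lam : ℝ} (hlam : 0 < lam) (f : ℝ → ℝ) :
    ∫ t, f t ∂(expMeasure lam) = ∫ t in Ioi 0, lam * Real.exp (-lam * t) * f t := by
  have hm : Measurable (exponentialPDF lam) := (measurable_exponentialPDFReal lam).ennreal_ofReal
  rw [← integral_Ici_eq_integral_Ioi, ← integral_indicator measurableSet_Ici]
  change ∫ t, f t ∂(volume.withDensity (exponentialPDF lam)) = _
  rw [integral_withDensity_eq_integral_toReal_smul hm (ae_of_all _ fun _ => ENNReal.ofReal_lt_top)]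
  refine integral_congr_ae (ae_of_all _ fun t => ?_)
  by_cases ht : 0 ≤ t
  · simp only [indicator, mem_Ici, ht, if_true, smul_eq_mul, exponentialPDF_of_nonneg ht]
    rw [ENNReal.toReal_ofReal (by positivity), neg_mul]
  · simp [indicator, ht, exponentialPDF_of_neg (not_le.1 ht)]

/-- The resolvent of the translation semigroup inverts `k - d/du`. -/
lemma hasDerivAt_integral_exp_mul_translate {k : ℝ} (hk : 0 < k) {h : ℝ → ℝ} (hh : Continuous h)
    {B : ℝ} (hB : ∀ s, |h s| ≤ B) (u : ℝ) :
    HasDerivAt (fun u => ∫ t in Ioi 0, Real.exp (-k * t) * h (u + t))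
      (k * (∫ t in Ioi 0, Real.exp (-k * t) * h (u + t)) - h u) u := by
  let F : ℝ → ℝ := fun s => Real.exp (-k * s) * h s
  have hFc : Continuous F := by fun_prop
  have hFi : ∀ a, IntegrableOn F (Ioi a) := fun a =>
    (integrableOn_exp_mul_Ioi (neg_lt_zero.2 hk) a).mul_bdd hh.aestronglyMeasurable
      (ae_of_all _ hB)
  -- The substitution `s = u + t`, after which `u` enters only through the lower limit.
  have hphi : ∀ u, ∫ t in Ioi 0, Real.exp (-k * t) * h (u + t)
      = Real.exp (k * u) * ((∫ s in Ioi 0, F s) - ∫ s in (0 : ℝ)..u, F s) := by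
    intro u
    rw [← intervalIntegral.integral_Ioi_sub_Ioi' (hFi 0) (hFi u), sub_sub_cancel,
      ← (measurePreserving_add_left volume u).setIntegral_preimage_emb
        (measurableEmbedding_addLeft u) F (Ioi u), ← integral_const_mul]
    simp only [preimage_const_add_Ioi, sub_self]
    refine integral_congr_ae (ae_of_all _ fun t => ?_)
    simp only [F]
    rw [← mul_assoc, ← Real.exp_add]
    ring_nf
  have hd : HasDerivAt (fun u => Real.exp (k * u) * ((∫ s in Ioi 0, F s) - ∫ s in (0 : ℝ)..u, F s))
      (Real.exp (k * u) * k * ((∫ s in Ioi 0, F s) - ∫ s in (0 : ℝ)..u, F s)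
        + Real.exp (k * u) * (0 - F u)) u := by
    have h1 : HasDerivAt (fun u => Real.exp (k * u)) (Real.exp (k * u) * k) u := by
      simpa using ((hasDerivAt_id u).const_mul k).exp
    exact h1.mul ((hasDerivAt_const u _).sub
      (intervalIntegral.integral_hasDerivAt_right (hFc.intervalIntegrable _ _)
        (hFc.stronglyMeasurableAtFilter _ _) hFc.continuousAt))
  have hF : Real.exp (k * u) * F u = h u := by
    simp only [F]
    rw [← mul_assoc, ← Real.exp_add]
    simp
  simp_rw [hphi]
  convert! hd using 1
  linear_combination hF

/-- Expected value right after a loss that hits the capital `u`. -/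
noncomputable def meanAfterLoss (r δ lam xstar y : ℝ) (G : Measure ℝ) (u : ℝ) : ℝ :=
  ∫ z, (costSeries r δ lam xstar y G (u * z)).toReal ∂G

lemma meanAfterLoss_eq_intervalIntegral {r δ lam xstar y : ℝ} {G : Measure ℝ}
    (hG : ∀ᵐ z ∂G, z ∈ Ioo (0 : ℝ) 1) (x : ℝ) :
    meanAfterLoss r δ lam xstar y G x
      = ∫ z in (0 : ℝ)..1, (costSeries r δ lam xstar y G (x * z)).toReal ∂G := by
  rw [intervalIntegral.integral_of_le zero_le_one, meanAfterLoss,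
    Measure.restrict_eq_self_of_ae_mem]
  filter_upwards [hG] with z hz using ⟨hz.1, hz.2.le⟩

section Dynamics

variable {r δ lam xstar y : ℝ} {G : Measure ℝ} [IsProbabilityMeasure G]

lemma abs_meanAfterLoss_le (hG : ∀ᵐ z ∂G, z ∈ Ioo (0 : ℝ) 1) {B : ℝ}
    (hB : ∀ x, 0 ≤ x → (costSeries r δ lam xstar y G x).toReal ≤ B) {u : ℝ} (hu : 0 ≤ u) :
    |meanAfterLoss r δ lam xstar y G u| ≤ B := by
  have := norm_integral_le_of_norm_le_const (μ := G) (C := B)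
    (f := fun z => (costSeries r δ lam xstar y G (u * z)).toReal) (by
      filter_upwards [hG] with z hz
      rw [Real.norm_of_nonneg ENNReal.toReal_nonneg]
      exact hB _ (mul_nonneg hu hz.1.le))
  simpa [meanAfterLoss] using this

lemma continuousOn_meanAfterLoss (hlam : 0 < lam) (hδ : 0 < δ)
    (hG : ∀ᵐ z ∂G, z ∈ Ioo (0 : ℝ) 1) (hxstar : 0 ≤ xstar) (hy : xstar ≤ y) :
    ContinuousOn (meanAfterLoss r δ lam xstar y G) (Ici 0) := by
  obtain ⟨B, hB⟩ := exists_toReal_costSeries_le (r := r) hlam hδ hG hxstar hy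
  have hVm : Measurable fun x => (costSeries r δ lam xstar y G x).toReal :=
    (measurable_costSeries hlam hδ hG hxstar hy).ennreal_toReal
  refine continuousOn_of_dominated (bound := fun _ => B)
    (fun u _ => (hVm.comp (measurable_const_mul u)).aestronglyMeasurable) (fun u hu => ?_)
    (integrable_const B) ?_
  · filter_upwards [hG] with z hz
    rw [Real.norm_of_nonneg ENNReal.toReal_nonneg]
    exact hB _ (mul_nonneg hu hz.1.le)
  · filter_upwards [hG] with z hz
    exact (continuousOn_toReal_costSeries hlam hδ hG hxstar hy).comp (by fun_prop)
      fun u hu => mul_nonneg hu hz.1.le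

lemma toReal_costSeries_eq_meanAfterLoss (hlam : 0 < lam) (hδ : 0 < δ)
    (hG : ∀ᵐ z ∂G, z ∈ Ioo (0 : ℝ) 1) (hxstar : 0 ≤ xstar) (hy : xstar ≤ y) {x : ℝ}
    (hx : y ≤ x) :
    (costSeries r δ lam xstar y G x).toReal = lam * ∫ t in Ioi 0, Real.exp (-(lam + δ) * t) *
      meanAfterLoss r δ lam xstar y G ((x - xstar) * Real.exp (r * t) + xstar) := by
  rw [toReal_costSeries_eq_integral hlam hδ hG hxstar hy hx, integral_expMeasure hlam,
    ← integral_const_mul]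
  refine integral_congr_ae (ae_of_all _ fun t => ?_)
  simp only [meanAfterLoss]
  rw [← mul_assoc, mul_assoc lam, ← Real.exp_add, mul_assoc]
  ring_nf

/-- In the coordinate `u` with `x - xstar = exp (r * u)` the flow is the translation, so above the
threshold the value function is a resolvent of the translation semigroup. -/
lemma hasDerivAt_toReal_costSeries (hr : 0 < r) (hlam : 0 < lam) (hδ : 0 < δ)
    (hG : ∀ᵐ z ∂G, z ∈ Ioo (0 : ℝ) 1) (hxstar : 0 ≤ xstar) (hy : xstar ≤ y) {x : ℝ}
    (hx : y < x) :
    HasDerivAt (fun x => (costSeries r δ lam xstar y G x).toReal)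
      (((δ + lam) * (costSeries r δ lam xstar y G x).toReal
        - lam * meanAfterLoss r δ lam xstar y G x) / (r * (x - xstar))) x := by
  obtain ⟨B, hB⟩ := exists_toReal_costSeries_le (r := r) hlam hδ hG hxstar hy
  set h : ℝ → ℝ := fun s => meanAfterLoss r δ lam xstar y G (Real.exp (r * s) + xstar) with hh
  have hpos : ∀ s, 0 ≤ Real.exp (r * s) + xstar := fun s => by positivity
  have hhc : Continuous h :=
    (continuousOn_meanAfterLoss hlam hδ hG hxstar hy).comp_continuous (by fun_prop) hpos
  have hhB : ∀ s, |h s| ≤ B := fun s => abs_meanAfterLoss_le hG hB (hpos s)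
  let φ : ℝ → ℝ := fun u => ∫ t in Ioi 0, Real.exp (-(lam + δ) * t) * h (u + t)
  have hexp : ∀ x, y < x → ∀ t, Real.exp (r * (Real.log (x - xstar) / r + t))
      = (x - xstar) * Real.exp (r * t) := by
    intro x hx t
    rw [mul_add, mul_div_cancel₀ _ hr.ne', Real.exp_add, Real.exp_log (by linarith)]
  have hV : ∀ x, y < x → (costSeries r δ lam xstar y G x).toReal
      = lam * φ (Real.log (x - xstar) / r) := by
    intro x hx
    rw [toReal_costSeries_eq_meanAfterLoss hlam hδ hG hxstar hy hx.le]
    simp only [φ, hh, hexp x hx]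
  have hx' : x - xstar ≠ 0 := by linarith
  have hlog : HasDerivAt (fun x => Real.log (x - xstar) / r) (1 / (x - xstar) / r) x :=
    (((hasDerivAt_id x).sub_const xstar).log hx').div_const r
  have hd := ((hasDerivAt_integral_exp_mul_translate (add_pos hlam hδ) hhc hhB
    (Real.log (x - xstar) / r)).comp x hlog).const_mul lam
  have hat : h (Real.log (x - xstar) / r) = meanAfterLoss r δ lam xstar y G x := by
    have := hexp x hx 0
    simp only [add_zero, mul_zero, Real.exp_zero, mul_one] at this
    simp only [hh, this, sub_add_cancel]
  refine (hd.congr_of_eventuallyEq ?_).congr_deriv ?_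
  · filter_upwards [Ioi_mem_nhds hx] with x hx
    exact hV x hx
  · rw [hat, hV x hx]
    change lam * (((lam + δ) * φ (Real.log (x - xstar) / r) - _) * _) = _
    generalize φ (Real.log (x - xstar) / r) = c
    field_simp
    ring

lemma contDiffOn_toReal_costSeries (hr : 0 < r) (hlam : 0 < lam) (hδ : 0 < δ)
    (hG : ∀ᵐ z ∂G, z ∈ Ioo (0 : ℝ) 1) (hxstar : 0 ≤ xstar) (hy : xstar ≤ y) :
    ContDiffOn ℝ 1 (fun x => (costSeries r δ lam xstar y G x).toReal) (Ioi y) := by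
  have hsub : Ioi y ⊆ Ici (0 : ℝ) := fun x hx => (hxstar.trans hy).trans (le_of_lt hx)
  rw [contDiffOn_one_iff_derivWithin isOpen_Ioi.uniqueDiffOn]
  refine ⟨fun x hx => (hasDerivAt_toReal_costSeries hr hlam hδ hG hxstar hy
    hx).differentiableAt.differentiableWithinAt, ?_⟩
  have hcont : ContinuousOn (fun x => ((δ + lam) * (costSeries r δ lam xstar y G x).toReal
      - lam * meanAfterLoss r δ lam xstar y G x) / (r * (x - xstar))) (Ioi y) := by
    refine ContinuousOn.div (((continuousOn_toReal_costSeries hlam hδ hG hxstar hy).mono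
      hsub).const_mul _ |>.sub (((continuousOn_meanAfterLoss hlam hδ hG hxstar hy).mono
      hsub).const_mul _)) (by fun_prop) fun x hx => ?_
    exact (mul_pos hr (by linarith [mem_Ioi.1 hx])).ne'
  refine hcont.congr fun x hx => ?_
  rw [derivWithin_of_isOpen isOpen_Ioi hx]
  exact (hasDerivAt_toReal_costSeries hr hlam hδ hG hxstar hy hx).deriv

lemma integrable_toReal_costSeries_mul (hlam : 0 < lam) (hδ : 0 < δ)
    (hG : ∀ᵐ z ∂G, z ∈ Ioo (0 : ℝ) 1) (hxstar : 0 ≤ xstar) (hy : xstar ≤ y) {x : ℝ}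
    (hx : 0 ≤ x) : Integrable (fun z => (costSeries r δ lam xstar y G (x * z)).toReal) G := by
  obtain ⟨B, hB⟩ := exists_toReal_costSeries_le (r := r) hlam hδ hG hxstar hy
  have hVm : Measurable fun x => (costSeries r δ lam xstar y G x).toReal :=
    (measurable_costSeries hlam hδ hG hxstar hy).ennreal_toReal
  refine Integrable.of_bound (hVm.comp (measurable_const_mul x)).aestronglyMeasurable B ?_
  filter_upwards [hG] with z hz
  rw [Real.norm_of_nonneg ENNReal.toReal_nonneg]
  exact hB _ (mul_nonneg hx hz.1.le)

lemma meanAfterLoss_eq_add (hlam : 0 < lam) (hδ : 0 < δ)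
    (hG : ∀ᵐ z ∂G, z ∈ Ioo (0 : ℝ) 1) (hxstar : 0 ≤ xstar) (hy : xstar ≤ y) {x : ℝ}
    (hx : y < x) :
    meanAfterLoss r δ lam xstar y G x
      = (∫ z in (y / x)..1, (costSeries r δ lam xstar y G (x * z)).toReal ∂G)
        + ∫ z in (0 : ℝ)..(y / x), ((y - x * z) + (costSeries r δ lam xstar y G y).toReal) ∂G := by
  have hy0 : 0 ≤ y := hxstar.trans hy
  have hx0 : 0 < x := hy0.trans_lt hx
  have hi := integrable_toReal_costSeries_mul (r := r) hlam hδ hG hxstar hy hx0.le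
  rw [meanAfterLoss_eq_intervalIntegral hG,
    ← intervalIntegral.integral_add_adjacent_intervals (b := y / x) hi.intervalIntegrable
      hi.intervalIntegrable, add_comm]
  congr 1
  refine intervalIntegral.integral_congr_ae (ae_of_all _ fun z hz => ?_)
  rw [uIoc_of_le (div_nonneg hy0 hx0.le)] at hz
  refine toReal_costSeries_of_le hlam hδ hG hxstar hy ?_
  rw [mul_comm]
  exact (le_div_iff₀ hx0).1 hz.2

lemma isClassicalSolution_costSeries (hr : 0 < r) (hlam : 0 < lam) (hδ : 0 < δ)
    (hG : ∀ᵐ z ∂G, z ∈ Ioo (0 : ℝ) 1) (hxstar : 0 ≤ xstar) (hy : xstar ≤ y) :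
    IsClassicalSolution r δ lam xstar G y (costSeries r δ lam xstar y G y).toReal
      (fun x => (costSeries r δ lam xstar y G x).toReal) where
  continuousOn := (continuousOn_toReal_costSeries hlam hδ hG hxstar hy).mono
    (Ici_subset_Ici.2 (hxstar.trans hy))
  contDiffOn := contDiffOn_toReal_costSeries hr hlam hδ hG hxstar hy
  boundary := rfl
  tendsto_zero := tendsto_toReal_costSeries hlam hδ hG hxstar hy
  equation x hx := by
    have hx' : r * (x - xstar) ≠ 0 := (mul_pos hr (by linarith)).ne'
    rw [thresholdOperator, (hasDerivAt_toReal_costSeries hr hlam hδ hG hxstar hy hx).deriv,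
      mul_div_cancel₀ _ hx', meanAfterLoss_eq_add hlam hδ hG hxstar hy hx]
    ring

/-- At the poverty line the capital stays put until the first loss, so dynamic programming gives an
algebraic equation instead of a differential one. -/
lemma costSeries_poverty_line (hlam : 0 < lam) (hδ : 0 < δ)
    (hG : ∀ᵐ z ∂G, z ∈ Ioo (0 : ℝ) 1) (hxstar : 0 ≤ xstar) :
    -(δ + lam) * (costSeries r δ lam xstar xstar G xstar).toReal
      + lam * (∫ z in (0 : ℝ)..1,
          ((xstar - xstar * z) + (costSeries r δ lam xstar xstar G xstar).toReal) ∂G) = 0 := by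
  have hk : 0 < lam + δ := add_pos hlam hδ
  have h1 := toReal_costSeries_eq_meanAfterLoss (r := r) hlam hδ hG hxstar le_rfl (le_refl xstar)
  simp only [sub_self, zero_mul, zero_add] at h1
  rw [integral_mul_const, integral_exp_mul_Ioi (neg_lt_zero.2 hk)] at h1
  have h2 : meanAfterLoss r δ lam xstar xstar G xstar = ∫ z in (0 : ℝ)..1,
      ((xstar - xstar * z) + (costSeries r δ lam xstar xstar G xstar).toReal) ∂G := by
    rw [meanAfterLoss_eq_intervalIntegral hG]
    refine intervalIntegral.integral_congr_ae (ae_of_all _ fun z hz => ?_)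
    rw [uIoc_of_le zero_le_one] at hz
    exact toReal_costSeries_of_le hlam hδ hG hxstar le_rfl (mul_le_of_le_one_right hxstar hz.2)
  rw [← h2]
  generalize (costSeries r δ lam xstar xstar G xstar).toReal = C at *
  rw [h1]
  simp only [mul_zero, Real.exp_zero]
  field_simp
  ring

end Dynamics

/-! ### Uniqueness of the classical solution -/

/-- Comparison by the maximum principle: at a positive maximum of `U - W` the derivative vanishes,
and the non-local term, averaging over smaller capitals with mass at most one, cannot make up for
the killing rate `δ > 0`. -/
lemma IsClassicalSolution.le {r δ lam xstar y v : ℝ} {G : Measure ℝ} [IsProbabilityMeasure G]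
    (hδ : 0 < δ) (hlam : 0 < lam) (hy : 0 ≤ y)
    {U W : ℝ → ℝ} (hU : IsClassicalSolution r δ lam xstar G y v U)
    (hW : IsClassicalSolution r δ lam xstar G y v W) {x : ℝ} (hx : y ≤ x) : U x ≤ W x := by
  by_contra! hlt
  have hD0 : Tendsto (fun x => U x - W x) atTop (𝓝 0) := by
    simpa using hU.tendsto_zero.sub hW.tendsto_zero
  have hDc : ContinuousOn (fun x => U x - W x) (Ici y) := hU.continuousOn.sub hW.continuousOn
  obtain ⟨M, hM⟩ := eventually_atTop.1 (hD0.eventually (gt_mem_nhds (sub_pos.2 hlt)))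
  obtain ⟨a, ha, hamax⟩ := (isCompact_Icc (a := y) (b := max M x)).exists_isMaxOn
    ⟨x, hx, le_max_right _ _⟩ (hDc.mono Icc_subset_Ici_self)
  have hxa : U x - W x ≤ U a - W a := hamax ⟨hx, le_max_right _ _⟩
  have hmax : ∀ z, y ≤ z → U z - W z ≤ U a - W a := by
    intro z hz
    rcases le_total z (max M x) with h | h
    · exact hamax ⟨hz, h⟩
    · exact (hM z ((le_max_left _ _).trans h)).le.trans hxa
  have hya : y < a := by
    refine lt_of_le_of_ne ha.1 ?_
    rintro rfl
    rw [hU.boundary, hW.boundary] at hxa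
    linarith
  have ha0 : 0 < a := hy.trans_lt hya
  have hdiff : ∀ {F}, IsClassicalSolution r δ lam xstar G y v F → DifferentiableAt ℝ F a :=
    fun hF => (hF.contDiffOn.differentiableOn one_ne_zero).differentiableAt (Ioi_mem_nhds hya)
  have hderiv : deriv U a = deriv W a := by
    have hloc : IsLocalMax (fun x => U x - W x) a := by
      filter_upwards [Ioi_mem_nhds hya] with z hz using hmax z (le_of_lt hz)
    have := hloc.deriv_eq_zero
    rw [deriv_fun_sub (hdiff hU) (hdiff hW)] at this
    linarith
  have hya1 : y / a ≤ 1 := (div_le_one ha0).2 hya.le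
  have hint : ∀ {F}, IsClassicalSolution r δ lam xstar G y v F →
      IntervalIntegrable (fun z => F (a * z)) G (y / a) 1 := fun hF =>
    ContinuousOn.intervalIntegrable (hF.continuousOn.comp (by fun_prop) fun z hz => by
      rw [uIcc_of_le hya1] at hz
      rw [mem_Ici, mul_comm]
      exact (div_le_iff₀ ha0).1 hz.1)
  have hle : (∫ z in (y / a)..1, U (a * z) ∂G) - (∫ z in (y / a)..1, W (a * z) ∂G)
      ≤ U a - W a := by
    rw [← intervalIntegral.integral_sub (hint hU) (hint hW)]
    have hpos : 0 ≤ U a - W a := by linarith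
    calc _ ≤ ∫ z in (y / a)..1, (U a - W a) ∂G := by
          refine intervalIntegral.integral_mono_on hya1 ((hint hU).sub (hint hW))
            intervalIntegrable_const fun z hz => hmax _ ?_
          rw [mul_comm]
          exact (div_le_iff₀ ha0).1 hz.1
      _ ≤ U a - W a := by
          rw [intervalIntegral.integral_of_le hya1, setIntegral_const, smul_eq_mul]
          exact mul_le_of_le_one_left hpos measureReal_le_one
  have h1 := hU.equation a hya
  have h2 := hW.equation a hya
  simp only [thresholdOperator, hU.boundary, hW.boundary, hderiv] at h1 h2
  nlinarith [mul_pos hδ (sub_pos.2 hlt), mul_le_mul_of_nonneg_left hxa hδ.le,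
    mul_le_mul_of_nonneg_left hle hlam.le]

end CashTransfer

theorem proposition4p2 {Ω : Type*} [MeasurableSpace Ω] (P : Measure Ω) [IsProbabilityMeasure P]
    (r δ lam xstar : ℝ) (hr : 0 < r) (hδ : 0 < δ) (hlam : 0 < lam) (hxstar : 0 ≤ xstar)
    (G : Measure ℝ) (τ Z : ℕ → Ω → ℝ) (hmodel : CashTransfer.IsLossModel P lam G τ Z)
    (y : ℝ) (hy : xstar ≤ y) :
    (∀ x, 0 ≤ x → CashTransfer.expectedCost P r δ xstar y τ Z x ≠ ⊤) ∧
    (∀ x, 0 ≤ x → x ≤ y →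
      CashTransfer.thresholdValue P r δ xstar y τ Z x
        = (y - x) + CashTransfer.thresholdValue P r δ xstar y τ Z y) ∧
    (∃ W : ℝ → ℝ,
      CashTransfer.IsClassicalSolution r δ lam xstar G y
        (CashTransfer.thresholdValue P r δ xstar y τ Z y) W ∧
      (∀ U : ℝ → ℝ, CashTransfer.IsClassicalSolution r δ lam xstar G y
        (CashTransfer.thresholdValue P r δ xstar y τ Z y) U → EqOn U W (Ici y)) ∧
      ∀ x, y < x → CashTransfer.thresholdValue P r δ xstar y τ Z x = W x) ∧
    ((∀ x, 0 ≤ x → CashTransfer.thresholdValue P r δ xstar xstar τ Z x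
        = CashTransfer.socialProtectionCost P r δ xstar τ Z x) ∧
      -(δ + lam) * CashTransfer.socialProtectionCost P r δ xstar τ Z xstar
        + lam * (∫ z in (0 : ℝ)..1,
            ((xstar - xstar * z) + CashTransfer.socialProtectionCost P r δ xstar τ Z xstar) ∂G)
        = 0) := by
  have := hmodel.isProbabilityMeasure_prop
  have hG := hmodel.prop_support
  have hcost : ∀ y x, CashTransfer.expectedCost P r δ xstar y τ Z x
      = CashTransfer.costSeries r δ lam xstar y G x := fun y x =>
    hmodel.expectedCost_eq_tsum hlam x
  simp only [CashTransfer.socialProtectionCost, CashTransfer.thresholdValue, hcost]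
  have hsol := CashTransfer.isClassicalSolution_costSeries hr hlam hδ hG hxstar hy
  have hy0 : 0 ≤ y := hxstar.trans hy
  exact ⟨fun x hx => CashTransfer.costSeries_ne_top hlam hδ hG hxstar hy hx,
    fun x _ hx => CashTransfer.toReal_costSeries_of_le hlam hδ hG hxstar hy hx,
    ⟨_, hsol, fun U hU x hx => le_antisymm (hU.le hδ hlam hy0 hsol hx)
      (hsol.le hδ hlam hy0 hU hx), fun _ _ => rfl⟩,
    fun _ _ => trivial, CashTransfer.costSeries_poverty_line hlam hδ hG hxstar⟩
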